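/- All graphs are finite, undirected and simple. A graph $H$ is a minor of a graph $G$ if there are pairwise disjoint connected (nonempty) subgraphs $(G_x)_{x\in V(H)}$ of $G$ such that whenever $xy\in E(H)$ some edge of $G$ joins a vertex of $G_x$ to a vertex of $G_y$. For $r\in\mathbb{N}$, a linear order $L$ of $V(G)$ and $v\in V(G)$, let $\mathrm{SReach}_r[G,L,v]$ be the set of vertices $u\le_L v$ for which there is a path in $G$ of length at most $r$ between $v$ and $u$ all of whose inner vertices $w$ satisfy $v<_L w$ (in particular $v\in \mathrm{SReach}_r[G,L,v]$). The $r$-colouring number of $G$ is $$\mathrm{col}_r(G)=\min_{L}\ \max_{v\in V(G)}\ \bigl|\mathrm{SReach}_r[G,L,v]\bigr|,$$ where $L$ ranges over all linear orders of $V(G)$ (and $\mathrm{col}_r(G)=0$ if $G$ has no vertices). **Theorem.** Let $H$ be a graph and $v$ a vertex of $H$. Set $h=|E(H-v)|$, and let $\alpha$ be the number of isolated vertices of $H-v$. Then for every graph $G$ that excludes $H$ as a minor and every $r\in\mathbb{N}$, we have $$\mathrm{col}_r(G)\ \le\ h\cdot(2r+1)+\alpha .$$ -/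

import Mathlib

namespace GenCol

/-- `H` is a minor of `G`: there are pairwise disjoint, nonempty, connected branch sets in `G`,
one for each vertex of `H`, such that the branch sets of adjacent vertices of `H` are joined by
an edge of `G`. (`SimpleGraph.Connected` includes nonemptiness.) -/
def IsMinor {W V : Type*} (H : SimpleGraph W) (G : SimpleGraph V) : Prop :=
  ∃ B : W → Set V,
    (∀ i, (G.induce (B i)).Connected) ∧
    (∀ i j, i ≠ j → Disjoint (B i) (B j)) ∧
    (∀ i j, H.Adj i j → ∃ x ∈ B i, ∃ y ∈ B j, G.Adj x y)

/-- The set of vertices `u` that are strongly `r`-reachable from `v` with respect to the linear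
order `L`: `u ≤ v` and there is a path of length at most `r` between `v` and `u` all of whose
inner vertices are greater than `v`. -/
def SReach {V : Type*} (G : SimpleGraph V) (L : LinearOrder V) (r : ℕ) (v : V) : Set V :=
  {u | L.le u v ∧ ∃ p : G.Walk v u, p.IsPath ∧ p.length ≤ r ∧
    ∀ w ∈ p.support, w ≠ v → w ≠ u → L.lt v w}

/-- The `r`-colouring number `col_r(G)`: the minimum over all linear orders of the vertices of
the maximum size of a strong `r`-reachability set. -/
noncomputable def col {V : Type*} (G : SimpleGraph V) (r : ℕ) : ℕ∞ :=
  ⨅ L : LinearOrder V, ⨆ v : V, (SReach G L r v).encard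

/-- The graph `H - v`. -/
abbrev deleteVertex {W : Type*} (H : SimpleGraph W) (v : W) :
    SimpleGraph ({v}ᶜ : Set W) :=
  H.induce {v}ᶜ

/-- The number of edges of a (finite) graph. -/
noncomputable def numEdges {W : Type*} (H : SimpleGraph W) : ℕ :=
  H.edgeSet.ncard

/-- The number of isolated vertices of a (finite) graph. -/
noncomputable def numIsolated {W : Type*} (H : SimpleGraph W) : ℕ :=
  {w : W | H.IsIsolated w}.ncard

end GenCol

/-!
Write `H'` for `H - v`. The vertices of `G` are put on levels by repeatedly cutting a piece `X` out
of a component `C` of what is left, and the levels give the linear order. A strongly reachable set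
of a vertex of `X` then lies in `X` together with the boundary of `C`, and only walks through `C`
matter. So it suffices to keep the boundary of every remaining component covered by few sets that
a vertex of `C` hardly reaches.

The cover comes from a partial minor model of `H'` (`PartialModel`) that has been built outside
`C`: a connected core for each modelled vertex, and a path between the cores for each modelled
edge. The bookkeeping (`Guards`) assigns the covering sets to the edges of `H'`: each edge owns
one set, of which `C` reaches at most `2 * r + 1` vertices, and each isolated vertex of `H'` owns
at most one vertex. This gives the bound `h * (2 * r + 1) + α`.

Two facts make the induction work.

* Each core meets the boundary of `C` in at most one vertex, and when `C` shrinks the model can be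
  repaired so that each core still in use meets it in exactly one (`Guards.exists_anchored`). The
  point is to leave the inner vertices of the linking paths unassigned. A core that has lost
  contact with `C` takes over inner vertices of one of its paths until it meets the boundary
  again. If none of its paths meets the boundary, then the core and all its paths can be dropped,
  and the sets of the edges concerned keep at most the one boundary vertex in the other core.
* If every core is in contact with `C`, then either a vertex of `H'` is missing and any single
  vertex of `C` can become its core (`Guards.exists_addVertex`), or an edge of `H'` is missing and
  a shortest path through `C` between two cores can represent it (`Guards.exists_addEdge`); being
  a geodesic, this path meets each ball of radius `r` in at most `2 * r + 1` vertices. If nothing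
  is missing, `C` itself can represent `v`, and `H` is a minor of `G`
  (`PartialModel.isMinor`).
-/

namespace GenCol

variable {W V : Type*}

/-! ### Linked sets -/

/-- The outer boundary of `C`: the vertices outside `C` with a neighbour in `C`. -/
def boundary (G : SimpleGraph V) (C : Set V) : Set V :=
  {u | u ∉ C ∧ ∃ a ∈ C, G.Adj a u}

/-- `I` is the set of inner vertices of a path of `G` from a vertex of `A` to a vertex of `B`. -/
def Linked (G : SimpleGraph V) (A B I : Set V) : Prop :=
  ∃ u ∈ A, ∃ w ∈ B, ∃ p : G.Walk u w, p.IsPath ∧ {v | v ∈ p.support ∧ v ≠ u ∧ v ≠ w} = I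

lemma Linked.symm {G : SimpleGraph V} {A B I : Set V} (h : Linked G A B I) : Linked G B A I := by
  obtain ⟨u, hu, w, hw, p, hp, rfl⟩ := h
  refine ⟨w, hw, u, hu, p.reverse, hp.reverse, ?_⟩
  ext v
  simp [and_comm]

lemma Linked.mono {G : SimpleGraph V} {A B A' B' I : Set V} (h : Linked G A B I)
    (hA : A ⊆ A') (hB : B ⊆ B') : Linked G A' B' I := by
  obtain ⟨u, hu, w, hw, p, hp, h⟩ := h
  exact ⟨u, hA hu, w, hB hw, p, hp, h⟩

/-- The first inner vertex of the linking path can be moved into the set where the path starts. -/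
lemma Linked.exists_shift {G : SimpleGraph V} {A B I : Set V} (h : Linked G A B I)
    (hI : I.Nonempty) :
    ∃ t ∈ I, (∃ u ∈ A, G.Adj u t) ∧ Linked G (insert t A) B (I \ {t}) := by
  obtain ⟨u, hu, w, hw, p, hp, rfl⟩ := h
  cases p with
  | nil =>
    obtain ⟨v, hv, hvu, -⟩ := hI
    simp_all
  | @cons _ t _ hadj q =>
    rw [SimpleGraph.Walk.cons_isPath_iff] at hp
    obtain ⟨hq, huq⟩ := hp
    have htw : t ≠ w := by
      rintro rfl
      obtain ⟨v, hv, h1, h2⟩ := hI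
      simp_all [SimpleGraph.Walk.nil_iff_support_eq]
    refine ⟨t, ⟨by simp, hadj.ne', htw⟩, ⟨u, hu, hadj⟩, t, by simp, w, hw, q, hq, ?_⟩
    ext v
    simp only [SimpleGraph.Walk.support_cons, List.mem_cons, Set.mem_sdiff, Set.mem_ofPred_eq,
      Set.mem_singleton_iff]
    constructor
    · rintro ⟨h1, h2, h3⟩
      exact ⟨⟨.inr h1, fun h => huq (h ▸ h1), h3⟩, h2⟩
    · rintro ⟨⟨h1, h2, h3⟩, h4⟩
      exact ⟨h1.resolve_left h2, h4, h3⟩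

lemma Linked.exists_adj {G : SimpleGraph V} {A B : Set V} (h : Linked G A B ∅)
    (hAB : Disjoint A B) : ∃ u ∈ A, ∃ w ∈ B, G.Adj u w := by
  obtain ⟨u, hu, w, hw, p, hp, hI⟩ := h
  refine ⟨u, hu, w, hw, ?_⟩
  cases p with
  | nil => exact absurd hw (Set.disjoint_left.1 hAB hu)
  | @cons _ t _ hadj q =>
    by_cases htw : t = w
    · exact htw ▸ hadj
    · have : t ∈ (∅ : Set V) := hI ▸ ⟨by simp, hadj.ne', htw⟩
      exact this.elim

lemma preconnected_induce_insert {G : SimpleGraph V} {A : Set V} (hA : (G.induce A).Preconnected)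
    {u t : V} (hu : u ∈ A) (hut : G.Adj u t) : (G.induce (insert t A)).Preconnected := by
  have h := SimpleGraph.induce_union_connected (G := G) (s := {u, t}) (t := A)
    (SimpleGraph.induce_pair_connected_of_adj hut).preconnected hA ⟨u, by simp, hu⟩
  have : ({u, t} : Set V) ∪ A = insert t A := by
    ext v
    simp only [Set.mem_union, Set.mem_insert_iff, Set.mem_singleton_iff]
    constructor
    · rintro ((rfl | h) | h)
      exacts [.inr hu, .inl h, .inr h]
    · rintro (h | h)
      exacts [.inl (.inr h), .inr h]
  rw [← this]
  exact h.preconnected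

/-! ### Partial minor models -/

/-- A partial minor model of `H` in `G`. Every vertex `x` of `H` has a connected set `core x`,
empty if `x` is not modelled. Every edge `xy` in `edges` is modelled by a path of `G` from
`core x` to `core y`, with set of inner vertices `inner s(x, y)`. Cores and inner sets are
pairwise disjoint. To turn this into a minor model, the inner vertices of each path have to be
divided between the two ends; that choice is deliberately left open. -/
structure PartialModel (H : SimpleGraph W) (G : SimpleGraph V) where
  /-- the connected set representing a vertex of `H`, or `∅` -/
  core : W → Set V
  /-- the modelled edges of `H` -/
  edges : Set (Sym2 W)
  /-- the inner vertices of the path representing a modelled edge; `∅` for other pairs -/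
  inner : Sym2 W → Set V
  preconnected : ∀ x, (G.induce (core x)).Preconnected
  disjoint_core : ∀ x y, x ≠ y → Disjoint (core x) (core y)
  disjoint_inner : ∀ e f, e ≠ f → Disjoint (inner e) (inner f)
  disjoint_inner_core : ∀ e x, Disjoint (inner e) (core x)
  inner_eq_empty : ∀ e, e ∉ edges → inner e = ∅
  edges_subset : edges ⊆ H.edgeSet
  linked : ∀ x y, s(x, y) ∈ edges → Linked G (core x) (core y) (inner s(x, y))

namespace PartialModel

variable {H : SimpleGraph W} {G : SimpleGraph V}

/-- The vertices of `G` used by the partial model avoid `C`. -/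
def Avoids (M : PartialModel H G) (C : Set V) : Prop :=
  (∀ x, Disjoint (M.core x) C) ∧ ∀ e, Disjoint (M.inner e) C

lemma Avoids.mono {M : PartialModel H G} {C C' : Set V} (h : M.Avoids C) (hC : C' ⊆ C) :
    M.Avoids C' :=
  ⟨fun x => (h.1 x).mono_right hC, fun e => (h.2 e).mono_right hC⟩

lemma ne_of_mem_edges (M : PartialModel H G) {x y : W} (h : s(x, y) ∈ M.edges) : x ≠ y :=
  (H.mem_edgeSet.1 (M.edges_subset h)).ne

lemma core_nonempty (M : PartialModel H G) {x y : W} (h : s(x, y) ∈ M.edges) :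
    (M.core x).Nonempty := by
  obtain ⟨u, hu, -⟩ := M.linked x y h
  exact ⟨u, hu⟩

/-- Move the inner vertex next to `core x` on the path of the edge `xy` into `core x`. -/
lemma exists_shift (M : PartialModel H G) {x y : W} (hxy : s(x, y) ∈ M.edges)
    (hI : (M.inner s(x, y)).Nonempty) :
    ∃ (M' : PartialModel H G) (t : V), t ∈ M.inner s(x, y) ∧ M'.edges = M.edges ∧
      M'.core x = insert t (M.core x) ∧ (∀ z, z ≠ x → M'.core z = M.core z) ∧
      M'.inner s(x, y) = M.inner s(x, y) \ {t} ∧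
      (∀ e, e ≠ s(x, y) → M'.inner e = M.inner e) ∧
      (∀ z, M.core z ⊆ M'.core z) ∧ (∀ e, M'.inner e ⊆ M.inner e) ∧
      ∀ C, M.Avoids C → M'.Avoids C := by
  classical
  obtain ⟨t, htI, ⟨u, hu, hut⟩, hlink⟩ := (M.linked x y hxy).exists_shift hI
  have hne := M.ne_of_mem_edges hxy
  have htc : ∀ z, t ∉ M.core z := fun z => Set.disjoint_left.1 (M.disjoint_inner_core _ z) htI
  have hti : ∀ e, e ≠ s(x, y) → t ∉ M.inner e := fun e he =>
    Set.disjoint_left.1 (M.disjoint_inner _ e he.symm) htI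
  let c : W → Set V := fun z => if z = x then insert t (M.core x) else M.core z
  let i : Sym2 W → Set V := fun e =>
    if e = s(x, y) then M.inner s(x, y) \ {t} else M.inner e
  have hcx : c x = insert t (M.core x) := if_pos rfl
  have hcz : ∀ z, z ≠ x → c z = M.core z := fun z hz => if_neg hz
  have hix : i s(x, y) = M.inner s(x, y) \ {t} := if_pos rfl
  have hie : ∀ e, e ≠ s(x, y) → i e = M.inner e := fun e he => if_neg he
  have hcmono : ∀ z, M.core z ⊆ c z := by
    intro z
    by_cases hz : z = x
    · subst hz; rw [hcx]; exact Set.subset_insert _ _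
    · rw [hcz z hz]
  have himono : ∀ e, i e ⊆ M.inner e := by
    intro e
    by_cases he : e = s(x, y)
    · subst he; rw [hix]; exact Set.sdiff_subset
    · rw [hie e he]
  have hit : ∀ e, t ∉ i e := by
    intro e
    by_cases he : e = s(x, y)
    · subst he; rw [hix]; simp
    · rw [hie e he]; exact hti e he
  have hcd : ∀ z, z ≠ x → Disjoint (c x) (c z) := by
    intro z hz
    rw [hcx, hcz z hz, Set.disjoint_insert_left]
    exact ⟨htc z, M.disjoint_core x z hz.symm⟩
  refine ⟨⟨c, M.edges, i, ?_, ?_, ?_, ?_, ?_, M.edges_subset, ?_⟩,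
    t, htI, rfl, hcx, hcz, hix, hie, hcmono, himono, fun C hC => ⟨fun z => ?_, fun e =>
      (hC.2 e).mono_left (himono e)⟩⟩
  · intro z
    by_cases hz : z = x
    · subst hz; rw [hcx]; exact preconnected_induce_insert (M.preconnected z) hu hut
    · rw [hcz z hz]; exact M.preconnected z
  · intro z w hzw
    by_cases hz : z = x
    · subst hz; exact hcd w hzw.symm
    · by_cases hw : w = x
      · subst hw; exact (hcd z hz).symm
      · rw [hcz z hz, hcz w hw]; exact M.disjoint_core z w hzw
  · intro e f hef
    exact (M.disjoint_inner e f hef).mono (himono e) (himono f)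
  · intro e z
    by_cases hz : z = x
    · subst hz
      rw [hcx, Set.disjoint_insert_right]
      exact ⟨hit e, (M.disjoint_inner_core e z).mono_left (himono e)⟩
    · rw [hcz z hz]; exact (M.disjoint_inner_core e z).mono_left (himono e)
  · intro e he
    exact Set.subset_empty_iff.1 ((himono e).trans (M.inner_eq_empty e he).subset)
  · intro z w hzw
    by_cases he : s(z, w) = s(x, y)
    · rw [he, hix]
      have hl : Linked G (c x) (c y) (M.inner s(x, y) \ {t}) := by
        rw [hcx, hcz y hne.symm]; exact hlink
      rcases Sym2.eq_iff.1 he with ⟨rfl, rfl⟩ | ⟨rfl, rfl⟩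
      exacts [hl, hl.symm]
    · rw [hie _ he]
      exact (M.linked z w hzw).mono (hcmono z) (hcmono w)
  · change Disjoint (c z) C
    by_cases hz : z = x
    · subst hz
      rw [hcx, Set.disjoint_insert_left]
      exact ⟨Set.disjoint_left.1 (hC.2 _) htI, hC.1 z⟩
    · rw [hcz z hz]; exact hC.1 z

/-- Delete the vertex `x` of `H`, and the edges at `x`, from the model. -/
lemma exists_delete (M : PartialModel H G) (x : W) :
    ∃ M' : PartialModel H G, M'.core x = ∅ ∧ (∀ z, z ≠ x → M'.core z = M.core z) ∧
      (∀ e, x ∈ e → M'.inner e = ∅) ∧ ∀ e, x ∉ e → M'.inner e = M.inner e := by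
  classical
  let c : W → Set V := fun z => if z = x then ∅ else M.core z
  let i : Sym2 W → Set V := fun e => if x ∈ e then ∅ else M.inner e
  have hcx : c x = ∅ := if_pos rfl
  have hcz : ∀ z, z ≠ x → c z = M.core z := fun z hz => if_neg hz
  have hix : ∀ e, x ∈ e → i e = ∅ := fun e he => if_pos he
  have hie : ∀ e, x ∉ e → i e = M.inner e := fun e he => if_neg he
  have hcsub : ∀ z, c z ⊆ M.core z := by
    intro z
    by_cases hz : z = x
    · subst hz; rw [hcx]; exact Set.empty_subset _
    · rw [hcz z hz]
  have hisub : ∀ e, i e ⊆ M.inner e := by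
    intro e
    by_cases he : x ∈ e
    · rw [hix e he]; exact Set.empty_subset _
    · rw [hie e he]
  refine ⟨⟨c, {e ∈ M.edges | x ∉ e}, i, ?_, ?_, ?_, ?_, ?_, ?_, ?_⟩, hcx, hcz, hix, hie⟩
  · intro z
    by_cases hz : z = x
    · subst hz; rw [hcx]; exact fun a => a.2.elim
    · rw [hcz z hz]; exact M.preconnected z
  · exact fun z w h => (M.disjoint_core z w h).mono (hcsub z) (hcsub w)
  · exact fun e f h => (M.disjoint_inner e f h).mono (hisub e) (hisub f)
  · exact fun e z => (M.disjoint_inner_core e z).mono (hisub e) (hcsub z)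
  · intro e he
    by_cases hx : x ∈ e
    · exact hix e hx
    · rw [hie e hx]; exact M.inner_eq_empty e fun h => he ⟨h, hx⟩
  · exact fun e he => M.edges_subset he.1
  · rintro z w ⟨hzw, hx⟩
    rw [hie _ hx, hcz z (by rintro rfl; simp at hx), hcz w (by rintro rfl; simp at hx)]
    exact M.linked z w hzw

/-- Model an unmodelled vertex `z` of `H` by a single new vertex `p` of `G`. -/
lemma exists_addVertex (M : PartialModel H G) {z : W} (hz : M.core z = ∅) {p : V}
    (hpc : ∀ x, p ∉ M.core x) (hpi : ∀ e, p ∉ M.inner e) :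
    ∃ M' : PartialModel H G, M'.core z = {p} ∧ (∀ x, x ≠ z → M'.core x = M.core x) ∧
      M'.inner = M.inner := by
  classical
  let c : W → Set V := fun x => if x = z then {p} else M.core x
  have hcz : c z = {p} := if_pos rfl
  have hcx : ∀ x, x ≠ z → c x = M.core x := fun x hx => if_neg hx
  have hcmono : ∀ x, M.core x ⊆ c x := by
    intro x
    by_cases hx : x = z
    · subst hx; rw [hz]; exact Set.empty_subset _
    · rw [hcx x hx]
  have hcd : ∀ x, x ≠ z → Disjoint (c z) (c x) := by
    intro x hx
    rw [hcz, hcx x hx, Set.disjoint_singleton_left]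
    exact hpc x
  refine ⟨⟨c, M.edges, M.inner, ?_, ?_, M.disjoint_inner, ?_, M.inner_eq_empty,
    M.edges_subset, fun x y h => (M.linked x y h).mono (hcmono x) (hcmono y)⟩, hcz, hcx, rfl⟩
  · intro x
    by_cases hx : x = z
    · subst hx; rw [hcz]; exact .of_subsingleton
    · rw [hcx x hx]; exact M.preconnected x
  · intro x y hxy
    by_cases hx : x = z
    · subst hx; exact hcd y hxy.symm
    · by_cases hy : y = z
      · subst hy; exact (hcd x hx).symm
      · rw [hcx x hx, hcx y hy]; exact M.disjoint_core x y hxy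
  · intro e x
    by_cases hx : x = z
    · subst hx; rw [hcz, Set.disjoint_singleton_right]; exact hpi e
    · rw [hcx x hx]; exact M.disjoint_inner_core e x

/-- Model an unmodelled edge `xy` of `H` by a path with new inner vertices. -/
lemma exists_addEdge (M : PartialModel H G) {x y : W} (hadj : H.Adj x y)
    (hxy : s(x, y) ∉ M.edges) {I : Set V} (hI : Linked G (M.core x) (M.core y) I)
    (hIc : ∀ z, Disjoint I (M.core z)) (hIi : ∀ e, Disjoint I (M.inner e)) :
    ∃ M' : PartialModel H G, M'.core = M.core ∧ M'.inner s(x, y) = I ∧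
      ∀ e, e ≠ s(x, y) → M'.inner e = M.inner e := by
  classical
  let i : Sym2 W → Set V := fun e => if e = s(x, y) then I else M.inner e
  have hix : i s(x, y) = I := if_pos rfl
  have hie : ∀ e, e ≠ s(x, y) → i e = M.inner e := fun e he => if_neg he
  have hid : ∀ e, e ≠ s(x, y) → Disjoint (i s(x, y)) (i e) := by
    intro e he
    rw [hix, hie e he]; exact hIi e
  refine ⟨⟨M.core, insert s(x, y) M.edges, i, M.preconnected, M.disjoint_core, ?_, ?_, ?_, ?_,
    ?_⟩, rfl, hix, hie⟩
  · intro e f hef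
    by_cases he : e = s(x, y)
    · subst he; exact hid f hef.symm
    · by_cases hf : f = s(x, y)
      · subst hf; exact (hid e he).symm
      · rw [hie e he, hie f hf]; exact M.disjoint_inner e f hef
  · intro e z
    by_cases he : e = s(x, y)
    · subst he; rw [hix]; exact hIc z
    · rw [hie e he]; exact M.disjoint_inner_core e z
  · intro e he
    rw [Set.mem_insert_iff, not_or] at he
    rw [hie e he.1]; exact M.inner_eq_empty e he.2
  · exact Set.insert_subset hadj M.edges_subset
  · intro z w hzw
    by_cases he : s(z, w) = s(x, y)
    · rw [he, hix]
      rcases Sym2.eq_iff.1 he with ⟨rfl, rfl⟩ | ⟨rfl, rfl⟩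
      exacts [hI, hI.symm]
    · rw [hie _ he]
      exact M.linked z w (hzw.resolve_left he)

/-- Move all inner vertices of the linking paths into the cores. -/
lemma exists_inner_eq_empty [Finite W] [Finite V] (M : PartialModel H G) {C : Set V}
    (hC : M.Avoids C) :
    ∃ M' : PartialModel H G, M'.Avoids C ∧ M'.edges = M.edges ∧
      (∀ x, M.core x ⊆ M'.core x) ∧ ∀ e, M'.inner e = ∅ := by
  induction hn : {q : Sym2 W × V | q.2 ∈ M.inner q.1}.ncard using Nat.strong_induction_on
    generalizing M with
  | _ n ih =>
    by_cases hall : ∀ e, M.inner e = ∅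
    · exact ⟨M, hC, rfl, fun x => subset_rfl, hall⟩
    push Not at hall
    obtain ⟨e, he⟩ := hall
    induction e using Sym2.ind with
    | _ x y =>
      have hxy : s(x, y) ∈ M.edges := by
        by_contra h
        rw [M.inner_eq_empty _ h] at he
        exact Set.not_nonempty_empty he
      obtain ⟨M₁, t, ht, hE, hcx, hcz, hix, hie, hmono, hsub, hav⟩ := M.exists_shift hxy he
      have hlt : {q : Sym2 W × V | q.2 ∈ M₁.inner q.1}.ncard < n := by
        rw [← hn]
        refine Set.ncard_lt_ncard ⟨fun q hq => hsub _ hq, fun h => ?_⟩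
        have := @h (s(x, y), t) ht
        simp [hix] at this
      obtain ⟨M₂, h1, h2, h3, h4⟩ := ih _ hlt M₁ (hav C hC) rfl
      exact ⟨M₂, h1, h2.trans hE, fun z => (hmono z).trans (h3 z), h4⟩

end PartialModel

/-! ### Guards -/

/-- From each vertex of `C` at most `2 * r + 1` vertices of `T` can be reached by walks of length
at most `r` that stay in `C` up to their last vertex. -/
def Thin (G : SimpleGraph V) (C : Set V) (r : ℕ) (T : Set V) : Prop :=
  ∀ v ∈ C, {u ∈ T | ∃ p : G.Walk v u, p.length ≤ r ∧
    ∀ w ∈ p.support, w ≠ u → w ∈ C}.encard ≤ ((2 * r + 1 : ℕ) : ℕ∞)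

lemma Thin.mono {G : SimpleGraph V} {C C' : Set V} {r : ℕ} {T T' : Set V} (h : Thin G C r T)
    (hC : C' ⊆ C) (hT : T' ⊆ T) : Thin G C' r T' := by
  intro v hv
  refine (Set.encard_le_encard ?_).trans (h v (hC hv))
  rintro u ⟨hu, p, hp, hw⟩
  exact ⟨hT hu, p, hp, fun w h1 h2 => hC (hw w h1 h2)⟩

/-- The sets `T e` guard the set `N` with respect to the partial model `M`: the part of `N` met
by each core is at most one vertex, `N` is covered by the cores of the isolated vertices of `H`
and by one set `T e` for each edge `e` of `H`, and each `T e` is thin in `C` and lives on the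
part of the model that belongs to `e`. -/
structure Guards {H : SimpleGraph W} {G : SimpleGraph V} (M : PartialModel H G)
    (T : Sym2 W → Set V) (r : ℕ) (N C : Set V) : Prop where
  subsingleton : ∀ x, (M.core x ∩ N).Subsingleton
  cover : ∀ u ∈ N, (∃ e ∈ H.edgeSet, u ∈ T e) ∨ ∃ x, H.IsIsolated x ∧ u ∈ M.core x
  subset : ∀ x y, T s(x, y) ⊆ M.core x ∪ M.core y ∪ M.inner s(x, y)
  thin : ∀ e, Thin G C r (T e)

lemma Guards.mono {H : SimpleGraph W} {G : SimpleGraph V} {M : PartialModel H G}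
    {T : Sym2 W → Set V} {r : ℕ} {N N' C C' : Set V} (h : Guards M T r N C) (hN : N' ⊆ N)
    (hC : C' ⊆ C) : Guards M T r N' C' :=
  ⟨fun x => (h.subsingleton x).anti (Set.inter_subset_inter_right _ hN),
    fun u hu => h.cover u (hN hu), h.subset, fun e => (h.thin e).mono hC subset_rfl⟩

/-- Guards can be chosen so that every vertex of `H` that is still modelled has a vertex of `N`
in its core. A core without such a vertex either grows along one of its linking paths that meets
`N`, or can be discarded together with all its paths. -/
lemma Guards.exists_anchored [Finite W] [Finite V] {H : SimpleGraph W} {G : SimpleGraph V}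
    {M : PartialModel H G} {T : Sym2 W → Set V} {r : ℕ} {N C A : Set V}
    (h : Guards M T r N C) (hA : M.Avoids A) :
    ∃ (M' : PartialModel H G) (T' : Sym2 W → Set V), Guards M' T' r N C ∧ M'.Avoids A ∧
      ∀ x, (M'.core x).Nonempty → (M'.core x ∩ N).Nonempty := by
  induction hn : {q : Sym2 W × V | q.2 ∈ M.inner q.1}.ncard + {x | (M.core x).Nonempty}.ncard
    using Nat.strong_induction_on generalizing M T with
  -- Growing a core lowers the first summand and keeps the second; deleting a vertex lowers the
  -- second and does not raise the first.
  | _ n ih =>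
    by_cases hall : ∀ x, (M.core x).Nonempty → (M.core x ∩ N).Nonempty
    · exact ⟨M, T, h, hA, hall⟩
    push Not at hall
    obtain ⟨x, hx, hxN⟩ := hall
    by_cases hex : ∃ y, (M.inner s(x, y) ∩ N).Nonempty
    · obtain ⟨y, hy⟩ := hex
      have hI := hy.mono Set.inter_subset_left
      have hxy : s(x, y) ∈ M.edges := by
        by_contra h
        rw [M.inner_eq_empty _ h] at hI
        exact Set.not_nonempty_empty hI
      obtain ⟨M₁, t, ht, hE, hcx, hcz, hix, hie, hmono, hsub, hav⟩ := M.exists_shift hxy hI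
      have hlt : {q : Sym2 W × V | q.2 ∈ M₁.inner q.1}.ncard +
          {z | (M₁.core z).Nonempty}.ncard < n := by
        rw [← hn]
        have h1 : {q : Sym2 W × V | q.2 ∈ M₁.inner q.1}.ncard <
            {q : Sym2 W × V | q.2 ∈ M.inner q.1}.ncard := by
          refine Set.ncard_lt_ncard ⟨fun q hq => hsub _ hq, fun h => ?_⟩
          have := @h (s(x, y), t) ht
          simp [hix] at this
        have h2 : {z | (M₁.core z).Nonempty} = {z | (M.core z).Nonempty} := by
          ext z
          refine ⟨fun hz => ?_, fun hz => Set.Nonempty.mono (hmono z) hz⟩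
          by_cases hzx : z = x
          · subst hzx; exact hx
          · rw [Set.mem_ofPred_eq, hcz z hzx] at hz; exact hz
        rw [h2]
        omega
      refine ih _ hlt (M := M₁) (T := T) ?_ (hav A hA) rfl
      refine ⟨fun z => ?_, fun u hu => ?_, fun z w => ?_, h.thin⟩
      · by_cases hz : z = x
        · subst hz
          -- the old core misses `N`, so only the new vertex `t` can lie in `N`
          have : M₁.core z ∩ N ⊆ {t} := by
            rintro u ⟨hu, huN⟩
            rw [hcx] at hu
            refine hu.resolve_right fun hu' => ?_
            have : u ∈ M.core z ∩ N := ⟨hu', huN⟩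
            rw [hxN] at this
            exact this
          exact Set.subsingleton_singleton.anti this
        · rw [hcz z hz]; exact h.subsingleton z
      · exact (h.cover u hu).imp_right fun ⟨z, hz, huz⟩ => ⟨z, hz, hmono z huz⟩
      · intro u hu
        rcases h.subset z w hu with (hu | hu) | hu
        · exact .inl (.inl (hmono z hu))
        · exact .inl (.inr (hmono w hu))
        · by_cases he : s(z, w) = s(x, y)
          · by_cases hut : u = t
            · subst hut
              have : u ∈ M₁.core x := by rw [hcx]; exact Set.mem_insert _ _
              rcases Sym2.eq_iff.1 he with ⟨rfl, rfl⟩ | ⟨rfl, rfl⟩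
              exacts [.inl (.inl this), .inl (.inr this)]
            · right
              rw [he, hix]
              exact ⟨he ▸ hu, hut⟩
          · right
            rw [hie _ he]
            exact hu
    · push Not at hex
      -- `N` misses `core x` and all paths at `x`; cutting the sets `T e` down to `N` therefore
      -- confines those of the edges at `x` to the other core
      obtain ⟨M₁, hcx, hcz, hix, hie⟩ := M.exists_delete x
      have hisub : ∀ e, M₁.inner e ⊆ M.inner e := by
        intro e
        by_cases he : x ∈ e
        · rw [hix e he]; exact Set.empty_subset _
        · rw [hie e he]
      have hcsub : ∀ z, M₁.core z ⊆ M.core z := by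
        intro z
        by_cases hz : z = x
        · subst hz; rw [hcx]; exact Set.empty_subset _
        · rw [hcz z hz]
      have hcore : ∀ z u, u ∈ N → u ∈ M.core z → u ∈ M₁.core z := by
        intro z u huN hu
        by_cases hz : z = x
        · subst hz
          have : u ∈ M.core z ∩ N := ⟨hu, huN⟩
          rw [hxN] at this
          exact this.elim
        · rw [hcz z hz]; exact hu
      have hinner : ∀ z w u, u ∈ N → u ∈ M.inner s(z, w) → u ∈ M₁.inner s(z, w) := by
        intro z w u huN hu
        by_cases he : x ∈ s(z, w)
        · obtain ⟨y, hy⟩ := he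
          have : u ∈ M.inner s(x, y) ∩ N := ⟨hy ▸ hu, huN⟩
          rw [hex y] at this
          exact this.elim
        · rw [hie _ he]; exact hu
      have hlt : {q : Sym2 W × V | q.2 ∈ M₁.inner q.1}.ncard +
          {z | (M₁.core z).Nonempty}.ncard < n := by
        rw [← hn]
        refine Nat.add_lt_add_of_le_of_lt (Set.ncard_le_ncard fun q hq => hisub _ hq)
          (Set.ncard_lt_ncard ⟨fun z hz => Set.Nonempty.mono (hcsub z) hz, fun h => ?_⟩)
        have : (M₁.core x).Nonempty := h hx
        rw [hcx] at this
        exact Set.not_nonempty_empty this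
      refine ih _ hlt (M := M₁) (T := fun e => T e ∩ N) ?_
        ⟨fun z => (hA.1 z).mono_left (hcsub z), fun e => (hA.2 e).mono_left (hisub e)⟩ rfl
      refine ⟨fun z => (h.subsingleton z).anti (Set.inter_subset_inter_left _ (hcsub z)),
        fun u hu => ?_, fun z w => ?_, fun e => (h.thin e).mono subset_rfl Set.inter_subset_left⟩
      · exact (h.cover u hu).imp (fun ⟨e, he, hue⟩ => ⟨e, he, hue, hu⟩)
          fun ⟨z, hz, huz⟩ => ⟨z, hz, hcore z u hu huz⟩
      · rintro u ⟨hu, huN⟩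
        exact (h.subset z w hu).imp (.imp (hcore z u huN) (hcore w u huN)) (hinner z w u huN)

/-! ### Thin paths -/

/-- A ball of radius `r` meets a geodesic in at most `2 * r + 1` vertices. -/
lemma encard_ball_inter_geodesic_le {K : SimpleGraph V} {a b : V} (p : K.Walk a b)
    (hp : p.length = K.dist a b) (v : V) (r : ℕ) :
    {u | u ∈ p.support ∧ K.Reachable v u ∧ K.dist v u ≤ r}.encard ≤ ((2 * r + 1 : ℕ) : ℕ∞) := by
  classical
  set S := {u | u ∈ p.support ∧ K.Reachable v u ∧ K.dist v u ≤ r} with hS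
  have hdist : ∀ u (hu : u ∈ p.support), (p.takeUntil u hu).length = K.dist a u := fun u hu =>
    SimpleGraph.length_eq_dist_of_subwalk hp (p.isSubwalk_takeUntil hu)
  have hinj : Set.InjOn (K.dist a) S := by
    intro u hu u' hu' h
    rw [← p.getVert_length_takeUntil hu.1, ← p.getVert_length_takeUntil hu'.1, hdist, hdist, h]
  rw [← hinj.encard_image]
  set m := sInf (K.dist a '' S) with hm
  have hsub : K.dist a '' S ⊆ Set.Icc m (m + 2 * r) := by
    intro d hd
    refine ⟨Nat.sInf_le hd, ?_⟩
    obtain ⟨u₀, hu₀, h₀⟩ := Nat.sInf_mem ⟨d, hd⟩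
    obtain ⟨u, hu, rfl⟩ := hd
    rw [← hm] at h₀
    have h1 := SimpleGraph.Reachable.dist_triangle_left (G := K)
      (p.takeUntil u₀ hu₀.1).reachable u
    have h2 := SimpleGraph.Reachable.dist_triangle_left (G := K) hu₀.2.1.symm u
    have h3 := hu₀.2.2
    have h4 := hu.2.2
    rw [SimpleGraph.dist_comm] at h3
    omega
  refine (Set.encard_le_encard hsub).trans ?_
  rw [← Finset.coe_Icc, Set.encard_coe_eq_coe_finsetCard, Nat.card_Icc]
  exact_mod_cast by omega

/-- Two vertices of the boundary of `C` are joined through `C` by a path that is thin in `C`.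
The path is shortest among those that use only edges with an end in `C`, which rules out the
edge between its two ends. -/
lemma exists_thin_path {G : SimpleGraph V} {C : Set V} (hC : (G.induce C).Preconnected) {a b : V}
    (ha : a ∈ boundary G C) (hb : b ∈ boundary G C) (hab : a ≠ b) (r : ℕ) :
    ∃ p : G.Walk a b, p.IsPath ∧ (∀ w ∈ p.support, w ≠ a → w ≠ b → w ∈ C) ∧
      (∃ w ∈ p.support, w ≠ a ∧ w ≠ b) ∧ Thin G C r {w | w ∈ p.support} := by
  obtain ⟨haC, c, hc, hca⟩ := ha
  obtain ⟨hbC, d, hd, hdb⟩ := hb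
  let D : Set V := insert a (insert b C)
  let K : SimpleGraph V :=
    { Adj := fun s t => G.Adj s t ∧ (s ∈ C ∨ t ∈ C) ∧ s ∈ D ∧ t ∈ D
      symm := ⟨fun s t h => ⟨h.1.symm, h.2.1.symm, h.2.2.2, h.2.2.1⟩⟩
      loopless := ⟨fun s h => h.1.ne rfl⟩ }
  have hCD : ∀ {u}, u ∈ C → u ∈ D := fun hu => .inr (.inr hu)
  have hKG : K ≤ G := fun s t h => h.1
  have hcd : K.Reachable c d := by
    let φ : G.induce C →g K := ⟨Subtype.val, fun {s t} h => ⟨h, .inl s.2, hCD s.2, hCD t.2⟩⟩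
    exact (hC ⟨c, hc⟩ ⟨d, hd⟩).map φ
  have hac : K.Adj a c := ⟨hca.symm, .inr hc, .inl rfl, hCD hc⟩
  have hdb' : K.Adj d b := ⟨hdb, .inl hd, hCD hd, .inr (.inl rfl)⟩
  obtain ⟨q, hq, hql⟩ := (hac.reachable.trans (hcd.trans hdb'.reachable)).exists_path_of_dist
  have hqD : ∀ w ∈ q.support, w ∈ D := by
    have hstep : ∀ {s t : V} (q : K.Walk s t), s ∈ D → ∀ w ∈ q.support, w ∈ D := by
      intro s t q
      induction q with
      | nil => intro hs w hw; simp_all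
      | cons h q ih =>
        intro hs w hw
        rw [SimpleGraph.Walk.support_cons, List.mem_cons] at hw
        rcases hw with rfl | hw
        exacts [hs, ih h.2.2.2 w hw]
    exact hstep q (.inl rfl)
  have hsupp : (q.mapLe hKG).support = q.support := by simp
  refine ⟨q.mapLe hKG, (SimpleGraph.Walk.isPath_mapLe hKG).2 hq, ?_, ?_, ?_⟩
  · intro w hw hwa hwb
    rw [hsupp] at hw
    exact ((hqD w hw).resolve_left hwa).resolve_left hwb
  · rw [hsupp]
    cases q with
    | nil => exact (hab rfl).elim
    | @cons _ t _ h q =>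
      refine ⟨t, by simp, h.1.ne', ?_⟩
      rintro rfl
      exact h.2.1.elim haC hbC
  · intro v hv
    refine (Set.encard_le_encard ?_).trans (encard_ball_inter_geodesic_le q hql v r)
    rintro u ⟨hu, p, hpr, hpC⟩
    rw [Set.mem_ofPred_eq, hsupp] at hu
    have hmem : ∀ w ∈ p.support, w ∈ D := by
      intro w hw
      by_cases h : w = u
      · exact h ▸ hqD u hu
      · exact hCD (hpC w hw h)
    have hK : ∀ e ∈ p.edges, e ∈ K.edgeSet := by
      intro e he
      induction e using Sym2.ind with
      | _ s t =>
        have hs := p.fst_mem_support_of_mem_edges he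
        have ht := p.snd_mem_support_of_mem_edges he
        have hst : G.Adj s t := p.adj_of_mem_edges he
        refine ⟨hst, ?_, hmem s hs, hmem t ht⟩
        by_cases h : s = u
        · exact .inr (hpC t ht (h ▸ hst.ne'))
        · exact .inl (hpC s hs h)
    exact ⟨hu, (p.transfer K hK).reachable,
      (SimpleGraph.dist_le (p.transfer K hK)).trans (by simpa using hpr)⟩

/-- A set of two vertices is thin. For `r = 0` this holds although `2 ≤ 2 * r + 1` fails, since a
walk of length `0` reaches only its start. -/
lemma thin_insert_subsingleton {G : SimpleGraph V} {C : Set V} {r : ℕ} {S : Set V}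
    (hS : S.Subsingleton) (p : V) : Thin G C r (insert p S) := by
  intro v hv
  rcases r.eq_zero_or_pos with rfl | hr
  · refine (Set.encard_le_encard (t := {v}) ?_).trans (by simp)
    rintro u ⟨-, q, hq, -⟩
    exact (SimpleGraph.Walk.eq_of_length_eq_zero (Nat.le_zero.1 hq)).symm
  · refine (Set.encard_le_encard fun u hu => hu.1).trans ((Set.encard_insert_le S p).trans ?_)
    calc S.encard + 1 ≤ 1 + 1 := by gcongr; exact Set.encard_le_one_iff_subsingleton.2 hS
      _ = ((2 : ℕ) : ℕ∞) := by norm_num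
      _ ≤ _ := by exact_mod_cast by omega

/-! ### Extending a guarded model -/

/-- If all vertices and edges of `H - v` are modelled outside a connected set `C` that is
adjacent to every core, then `C` can represent `v`. -/
lemma PartialModel.isMinor [Finite W] [Finite V] {H : SimpleGraph W} {v : W} {G : SimpleGraph V}
    (M : PartialModel (deleteVertex H v) G) {C : Set V} (hC : (G.induce C).Connected)
    (hA : M.Avoids C) (hM : M.edges = (deleteVertex H v).edgeSet)
    (hb : ∀ x, (M.core x ∩ boundary G C).Nonempty) : IsMinor H G := by
  classical
  obtain ⟨M', hA', hE, hmono, hI⟩ := M.exists_inner_eq_empty hA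
  have hvx : ∀ x, ∃ a ∈ C, ∃ u ∈ M'.core x, G.Adj a u := by
    intro x
    obtain ⟨u, hu, -, a, ha, hau⟩ := hb x
    exact ⟨a, ha, u, hmono x hu, hau⟩
  let B : W → Set V := fun w => if h : w = v then C else M'.core ⟨w, h⟩
  have hBv : B v = C := dif_pos rfl
  have hBw : ∀ w (h : w ≠ v), B w = M'.core ⟨w, h⟩ := fun w h => dif_neg h
  refine ⟨B, ?_, ?_, ?_⟩
  · intro w
    by_cases h : w = v
    · subst h; rw [hBv]; exact hC
    · rw [hBw w h]
      obtain ⟨a, -, u, hu, -⟩ := hvx ⟨w, h⟩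
      have : Nonempty (M'.core ⟨w, h⟩) := ⟨⟨u, hu⟩⟩
      exact ⟨M'.preconnected _⟩
  · intro w z hwz
    by_cases hw : w = v
    · subst hw; rw [hBv, hBw z hwz.symm]; exact (hA'.1 _).symm
    · by_cases hz : z = v
      · subst hz; rw [hBv, hBw w hw]; exact hA'.1 _
      · rw [hBw w hw, hBw z hz]
        exact M'.disjoint_core _ _ fun h => hwz (congrArg Subtype.val h)
  · intro w z hwz
    by_cases hw : w = v
    · subst hw
      rw [hBv, hBw z hwz.ne']
      exact hvx _
    · by_cases hz : z = v
      · subst hz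
        rw [hBv, hBw w hw]
        obtain ⟨a, ha, u, hu, hau⟩ := hvx ⟨w, hw⟩
        exact ⟨u, hu, a, ha, hau.symm⟩
      · rw [hBw w hw, hBw z hz]
        have he : s((⟨w, hw⟩ : ({v}ᶜ : Set W)), ⟨z, hz⟩) ∈ M'.edges := by
          rw [hE, hM]; exact hwz
        have hl := M'.linked _ _ he
        rw [hI] at hl
        exact hl.exists_adj (M'.disjoint_core _ _ (M'.ne_of_mem_edges he))

/-- An unmodelled vertex `z` of `H` can be represented by any vertex of `C`. The new vertex is
guarded by the set of an edge at `z`, which so far guards at most one vertex. -/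
lemma Guards.exists_addVertex {H : SimpleGraph W} {G : SimpleGraph V}
    {M : PartialModel H G} {T : Sym2 W → Set V} {r : ℕ} {N C : Set V}
    (h : Guards M T r N C) (hA : M.Avoids C) {z : W} (hz : M.core z = ∅) {p : V} (hp : p ∈ C) :
    ∃ (M' : PartialModel H G) (T' : Sym2 W → Set V), M'.Avoids (C \ {p}) ∧
      Guards M' T' r (N ∪ {p}) C := by
  classical
  have hpc : ∀ x, p ∉ M.core x := fun x hx => Set.disjoint_left.1 (hA.1 x) hx hp
  obtain ⟨M', hcz, hcx, hi⟩ := M.exists_addVertex hz hpc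
    fun e he => Set.disjoint_left.1 (hA.2 e) he hp
  have hmono : ∀ x, M.core x ⊆ M'.core x := by
    intro x
    by_cases hx : x = z
    · subst hx; rw [hz]; exact Set.empty_subset _
    · rw [hcx x hx]
  have hA' : M'.Avoids (C \ {p}) := by
    refine ⟨fun x => ?_, fun e => ?_⟩
    · by_cases hx : x = z
      · subst hx; rw [hcz]; exact Set.disjoint_sdiff_right
      · rw [hcx x hx]; exact (hA.1 x).mono_right Set.sdiff_subset
    · rw [hi]; exact (hA.2 e).mono_right Set.sdiff_subset
  have hsubs : ∀ x, (M'.core x ∩ (N ∪ {p})).Subsingleton := by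
    intro x
    by_cases hx : x = z
    · subst hx
      rw [hcz]
      exact Set.subsingleton_singleton.anti Set.inter_subset_left
    · rw [hcx x hx]
      refine (h.subsingleton x).anti ?_
      rintro u ⟨hu, huN | rfl⟩
      exacts [⟨hu, huN⟩, (hpc x hu).elim]
  have hsub : ∀ x y, T s(x, y) ⊆ M'.core x ∪ M'.core y ∪ M'.inner s(x, y) := by
    intro x y
    rw [hi]
    exact (h.subset x y).trans (Set.union_subset_union_left _
      (Set.union_subset_union (hmono x) (hmono y)))
  by_cases hiso : H.IsIsolated z
  · refine ⟨M', T, hA', hsubs, ?_, hsub, h.thin⟩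
    rintro u (hu | rfl)
    · exact (h.cover u hu).imp_right fun ⟨x, hx, hux⟩ => ⟨x, hx, hmono x hux⟩
    · exact .inr ⟨z, hiso, by rw [hcz]; rfl⟩
  · obtain ⟨w, hw⟩ : ∃ w, H.Adj z w := by simpa [SimpleGraph.IsIsolated] using hiso
    -- `core z` and the inner set of `zw` are empty, so `T s(z, w)` lies in `core w` and has at
    -- most one vertex in `N`
    let T' : Sym2 W → Set V := fun e => if e = s(z, w) then insert p (T e ∩ N) else T e
    have hTz : T' s(z, w) = insert p (T s(z, w) ∩ N) := if_pos rfl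
    have hTe : ∀ e, e ≠ s(z, w) → T' e = T e := fun e he => if_neg he
    have hinner : M.inner s(z, w) = ∅ := M.inner_eq_empty _ fun he => by
      have := M.core_nonempty he
      rw [hz] at this
      exact Set.not_nonempty_empty this
    have hTw : T s(z, w) ⊆ M.core w := by
      have := h.subset z w
      rwa [hz, hinner, Set.empty_union, Set.union_empty] at this
    refine ⟨M', T', hA', hsubs, ?_, ?_, ?_⟩
    · rintro u (hu | rfl)
      · refine (h.cover u hu).imp (fun ⟨e, he, hue⟩ => ⟨e, he, ?_⟩)
          fun ⟨x, hx, hux⟩ => ⟨x, hx, hmono x hux⟩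
        by_cases hez : e = s(z, w)
        · subst hez; rw [hTz]; exact .inr ⟨hue, hu⟩
        · rw [hTe e hez]; exact hue
      · exact .inl ⟨s(z, w), hw, by rw [hTz]; exact .inl rfl⟩
    · intro x y
      by_cases he : s(x, y) = s(z, w)
      · rw [he, hTz]
        have : insert p (T s(z, w) ∩ N) ⊆ M'.core z ∪ M'.core w := by
          refine Set.insert_subset (.inl (by rw [hcz]; rfl)) fun u hu => .inr ?_
          exact hmono w (hTw hu.1)
        refine this.trans (Set.subset_union_of_subset_left ?_ _)
        rcases Sym2.eq_iff.1 he with ⟨rfl, rfl⟩ | ⟨rfl, rfl⟩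
        exacts [subset_rfl, (Set.union_comm _ _).subset]
      · rw [hTe _ he]; exact hsub x y
    · intro e
      by_cases he : e = s(z, w)
      · subst he
        rw [hTz]
        exact thin_insert_subsingleton
          ((h.subsingleton w).anti (Set.inter_subset_inter_left _ hTw)) p
      · rw [hTe e he]; exact h.thin e

/-- An unmodelled edge `xy` of `H` between modelled vertices can be represented by a thin path
through `C`. The path contains the only two vertices of the boundary that the set of `xy`
guarded before. -/
lemma Guards.exists_addEdge {H : SimpleGraph W} {G : SimpleGraph V}
    {M : PartialModel H G} {T : Sym2 W → Set V} {r : ℕ} {C : Set V}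
    (h : Guards M T r (boundary G C) C) (hA : M.Avoids C) (hC : (G.induce C).Preconnected)
    {x y : W} (hadj : H.Adj x y) (hxy : s(x, y) ∉ M.edges)
    (hx : (M.core x ∩ boundary G C).Nonempty) (hy : (M.core y ∩ boundary G C).Nonempty) :
    ∃ X ⊆ C, X.Nonempty ∧ ∃ (M' : PartialModel H G) (T' : Sym2 W → Set V),
      M'.Avoids (C \ X) ∧ Guards M' T' r (boundary G C ∪ X) C := by
  classical
  obtain ⟨a, hax, ha⟩ := hx
  obtain ⟨b, hby, hb⟩ := hy
  have hab : a ≠ b := by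
    rintro rfl
    exact Set.disjoint_left.1 (M.disjoint_core x y hadj.ne) hax hby
  obtain ⟨p, hp, hpC, ⟨w, hw, hwa, hwb⟩, hthin⟩ := exists_thin_path hC ha hb hab r
  set X := {v | v ∈ p.support ∧ v ≠ a ∧ v ≠ b} with hX
  have hXC : X ⊆ C := fun v hv => hpC v hv.1 hv.2.1 hv.2.2
  obtain ⟨M', hc, hix, hie⟩ := M.exists_addEdge (I := X) hadj hxy ⟨a, hax, b, hby, p, hp, rfl⟩
    (fun z => ((hA.1 z).mono_right hXC).symm) fun e => ((hA.2 e).mono_right hXC).symm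
  let T' : Sym2 W → Set V := fun e => if e = s(x, y) then {v | v ∈ p.support} else T e
  have hTx : T' s(x, y) = {v | v ∈ p.support} := if_pos rfl
  have hTe : ∀ e, e ≠ s(x, y) → T' e = T e := fun e he => if_neg he
  have hTxy : T s(x, y) ⊆ M.core x ∪ M.core y := by
    have := h.subset x y
    rwa [M.inner_eq_empty _ hxy, Set.union_empty] at this
  refine ⟨X, hXC, ⟨w, hw, hwa, hwb⟩, M', T', ⟨?_, ?_⟩, ?_, ?_, ?_, ?_⟩
  · intro z
    rw [hc]; exact (hA.1 z).mono_right Set.sdiff_subset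
  · intro e
    by_cases he : e = s(x, y)
    · subst he; rw [hix]; exact Set.disjoint_sdiff_right
    · rw [hie e he]; exact (hA.2 e).mono_right Set.sdiff_subset
  · intro z
    rw [hc]
    refine (h.subsingleton z).anti ?_
    rintro u ⟨hu, huN | huX⟩
    exacts [⟨hu, huN⟩, (Set.disjoint_left.1 (hA.1 z) hu (hXC huX)).elim]
  · rw [hc]
    rintro u (hu | hu)
    · refine (h.cover u hu).imp_left fun ⟨e, he, hue⟩ => ⟨e, he, ?_⟩
      by_cases hex : e = s(x, y)
      · subst hex
        rw [hTx]
        rcases hTxy hue with hu' | hu'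
        · rw [h.subsingleton x ⟨hu', hu⟩ ⟨hax, ha⟩]; exact p.start_mem_support
        · rw [h.subsingleton y ⟨hu', hu⟩ ⟨hby, hb⟩]; exact p.end_mem_support
      · rw [hTe e hex]; exact hue
    · exact .inl ⟨s(x, y), hadj, by rw [hTx]; exact hu.1⟩
  · intro z w
    rw [hc]
    by_cases he : s(z, w) = s(x, y)
    · rw [he, hTx, hix]
      have : {v | v ∈ p.support} ⊆ M.core x ∪ M.core y ∪ X := by
        intro u hu
        by_cases hua : u = a
        · exact .inl (.inl (hua ▸ hax))
        · by_cases hub : u = b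
          · exact .inl (.inr (hub ▸ hby))
          · exact .inr ⟨hu, hua, hub⟩
      rcases Sym2.eq_iff.1 he with ⟨rfl, rfl⟩ | ⟨rfl, rfl⟩
      exacts [this, Set.union_comm (M.core z) (M.core w) ▸ this]
    · rw [hTe _ he, hie _ he]; exact h.subset z w
  · intro e
    by_cases he : e = s(x, y)
    · subst he; rw [hTx]; exact hthin
    · rw [hTe e he]; exact h.thin e

/-- As long as `H` is not a minor of `G`, a guarded connected set `C` can be broken up further:
some nonempty `X ⊆ C` can be removed so that the boundary of `C` together with `X` is guarded. -/
lemma Guards.exists_step [Finite W] [Finite V] {H : SimpleGraph W} {v : W} {G : SimpleGraph V}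
    (hG : ¬ IsMinor H G) {M : PartialModel (deleteVertex H v) G}
    {T : Sym2 ({v}ᶜ : Set W) → Set V} {r : ℕ} {C : Set V}
    (h : Guards M T r (boundary G C) C) (hA : M.Avoids C) (hC : (G.induce C).Connected) :
    ∃ X ⊆ C, X.Nonempty ∧ ∃ (M' : PartialModel (deleteVertex H v) G)
      (T' : Sym2 ({v}ᶜ : Set W) → Set V),
      M'.Avoids (C \ X) ∧ Guards M' T' r (boundary G C ∪ X) C := by
  obtain ⟨M, T, h, hA, hanch⟩ := h.exists_anchored hA
  by_cases hcore : ∃ z, M.core z = ∅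
  · obtain ⟨z, hz⟩ := hcore
    obtain ⟨⟨p, hp⟩⟩ := hC.nonempty
    exact ⟨{p}, by simpa using hp, by simp, h.exists_addVertex hA hz hp⟩
  have hanch' : ∀ x, (M.core x ∩ boundary G C).Nonempty := fun x =>
    hanch x (Set.nonempty_iff_ne_empty.2 fun hx => hcore ⟨x, hx⟩)
  by_cases hE : M.edges = (deleteVertex H v).edgeSet
  · exact (hG (M.isMinor hC hA hE hanch')).elim
  · obtain ⟨e, he, heM⟩ := Set.exists_of_ssubset (M.edges_subset.ssubset_of_ne hE)
    induction e using Sym2.ind with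
    | _ x y => exact h.exists_addEdge hA hC.preconnected he heM (hanch' x) (hanch' y)

/-! ### Components -/

/-- `C` is the vertex set of a component of `G.induce D`. -/
structure IsComponent (G : SimpleGraph V) (D C : Set V) : Prop where
  subset : C ⊆ D
  connected : (G.induce C).Connected
  closed : ∀ a ∈ C, ∀ b ∈ D, G.Adj a b → b ∈ C

lemma exists_isComponent [Finite V] (G : SimpleGraph V) {D : Set V} (hD : D.Nonempty) :
    ∃ C, IsComponent G D C := by
  obtain ⟨v, hv⟩ := hD
  obtain ⟨C, hCv, hC⟩ := Set.Finite.exists_le_maximal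
    (Set.toFinite {C : Set V | C ⊆ D ∧ (G.induce C).Connected})
    (a := {v}) ⟨by simpa using hv, ⟨.of_subsingleton⟩⟩
  refine ⟨C, hC.prop.1, hC.prop.2, fun a ha b hb hab => ?_⟩
  have hins : insert b C ∈ {C : Set V | C ⊆ D ∧ (G.induce C).Connected} := by
    refine ⟨Set.insert_subset hb hC.prop.1, ?_⟩
    have : Nonempty (insert b C : Set V) := ⟨⟨b, Set.mem_insert _ _⟩⟩
    exact ⟨preconnected_induce_insert hC.prop.2.preconnected ha hab⟩
  exact hC.le_of_ge hins (Set.subset_insert b C) (Set.mem_insert b C)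

/-- A connected subset of `D` that meets a component of `D` is contained in it. -/
lemma IsComponent.subset_of_connected {G : SimpleGraph V} {D C C' : Set V}
    (hC : IsComponent G D C) (hD : C' ⊆ D) (hC' : (G.induce C').Preconnected)
    (h : (C' ∩ C).Nonempty) : C' ⊆ C := by
  obtain ⟨a, ha, haC⟩ := h
  intro b hb
  obtain ⟨p⟩ := hC' ⟨a, ha⟩ ⟨b, hb⟩
  have key : ∀ {s t : C'} (p : (G.induce C').Walk s t), (s : V) ∈ C → (t : V) ∈ C := by
    intro s t p
    induction p with
    | nil => exact id
    | cons hst _ ih => exact fun hs => ih (hC.closed _ hs _ (hD (Subtype.prop _)) hst)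
  exact key p haC

/-- A path that starts in a component `C` of `D`, and stays in `D` up to its last vertex, stays in
`C` up to its last vertex, which lies in `C` or, if it is not in `D`, in the boundary of `C`. -/
lemma IsComponent.path_mem {G : SimpleGraph V} {D C : Set V} (hC : IsComponent G D C) {v u : V}
    (p : G.Walk v u) (hpath : p.IsPath) (hv : v ∈ C) (hp : ∀ w ∈ p.support, w ≠ u → w ∈ D) :
    (∀ w ∈ p.support, w ≠ u → w ∈ C) ∧ (u ∈ C ∨ u ∉ D ∧ u ∈ boundary G C) := by
  induction p with
  | nil => exact ⟨fun w hw hne => by simp_all, .inl hv⟩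
  | @cons v t u h q ih =>
    rw [SimpleGraph.Walk.cons_isPath_iff] at hpath
    have hq : ∀ w ∈ q.support, w ≠ u → w ∈ D := fun w hw => hp w (by simp [hw])
    have hcons : (∀ w ∈ q.support, w ≠ u → w ∈ C) →
        ∀ w ∈ (SimpleGraph.Walk.cons h q).support, w ≠ u → w ∈ C := by
      intro hq w hw hne
      rw [SimpleGraph.Walk.support_cons, List.mem_cons] at hw
      rcases hw with rfl | hw
      exacts [hv, hq w hw hne]
    by_cases htD : t ∈ D
    · have := ih hpath.1 (hC.closed v hv t htD h) hq
      exact ⟨hcons this.1, this.2⟩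
    · have htu : t = u := by
        by_contra htu
        exact htD (hp t (by simp) htu)
      subst htu
      have hnil := SimpleGraph.Walk.isPath_iff_nil.1 hpath.1
      rw [SimpleGraph.Walk.nil_iff_support_eq] at hnil
      refine ⟨hcons fun w hw hne => ?_, .inr ⟨htD, fun h => htD (hC.subset h), v, hv, h⟩⟩
      rw [hnil, List.mem_singleton] at hw
      exact (hne hw).elim

/-! ### Levels -/

lemma encard_biUnion_le_ncard_mul {ι : Type*} [Finite ι] (s : Set ι) (t : ι → Set V) (k : ℕ)
    (h : ∀ i, (t i).encard ≤ k) : (⋃ i ∈ s, t i).encard ≤ ((s.ncard * k : ℕ) : ℕ∞) := by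
  classical
  have := Fintype.ofFinite ι
  have h1 := s.toFinset.set_encard_biUnion_le t
  simp only [Set.mem_toFinset] at h1
  refine h1.trans ((Finset.sum_le_card_nsmul _ _ (k : ℕ∞) fun i _ => h i).trans ?_)
  rw [Set.ncard_eq_toFinset_card', nsmul_eq_mul, Nat.cast_mul]

/-- A vertex of `C` reaches at most `2 * r + 1` guarded vertices for each edge of `H`, and at most
one for each isolated vertex. -/
lemma Guards.encard_reach_le [Finite W] {H : SimpleGraph W} {G : SimpleGraph V}
    {M : PartialModel H G} {T : Sym2 W → Set V} {r : ℕ} {N C : Set V} (h : Guards M T r N C)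
    {v : V} (hv : v ∈ C) :
    {u ∈ N | ∃ p : G.Walk v u, p.length ≤ r ∧ ∀ w ∈ p.support, w ≠ u → w ∈ C}.encard ≤
      ((numEdges H * (2 * r + 1) + numIsolated H : ℕ) : ℕ∞) := by
  have hsub : {u ∈ N | ∃ p : G.Walk v u, p.length ≤ r ∧ ∀ w ∈ p.support, w ≠ u → w ∈ C} ⊆
      (⋃ e ∈ H.edgeSet, {u ∈ T e | ∃ p : G.Walk v u, p.length ≤ r ∧
        ∀ w ∈ p.support, w ≠ u → w ∈ C}) ∪ ⋃ x ∈ {x | H.IsIsolated x}, M.core x ∩ N := by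
    rintro u ⟨hu, hp⟩
    rcases h.cover u hu with ⟨e, he, hue⟩ | ⟨x, hx, hux⟩
    · exact .inl (Set.mem_biUnion he ⟨hue, hp⟩)
    · exact .inr (Set.mem_biUnion hx ⟨hux, hu⟩)
  refine (Set.encard_le_encard hsub).trans ((Set.encard_union_le _ _).trans ?_)
  rw [Nat.cast_add]
  gcongr
  · exact encard_biUnion_le_ncard_mul _ _ _ fun e => h.thin e v hv
  · rw [← mul_one (numIsolated H)]
    exact encard_biUnion_le_ncard_mul _ _ _ fun x => by
      simpa using Set.encard_le_one_iff_subsingleton.2 (h.subsingleton x)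

/-- The vertices reached from `v` by paths of length at most `r` that stay in `D`, and on levels
not below that of `v`, up to their last vertex; if that vertex lies in `D`, its level must not be
above that of `v`. -/
def levelReach (G : SimpleGraph V) (D : Set V) (f : V → ℕ) (r : ℕ) (v : V) : Set V :=
  {u | (u ∈ D → f u ≤ f v) ∧ ∃ p : G.Walk v u, p.IsPath ∧ p.length ≤ r ∧
    ∀ w ∈ p.support, w ≠ u → w ∈ D ∧ f v ≤ f w}

/-- If all components of `D` are guarded, then `D` has a level function with small reachability
sets. The set `X` split off from a component becomes the lowest level, and the remaining
components are treated recursively. -/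
lemma exists_level [Finite W] [Finite V] {H : SimpleGraph W} {v : W} {G : SimpleGraph V}
    (hG : ¬ IsMinor H G) (r : ℕ) (D : Set V)
    (hD : ∀ C, IsComponent G D C → ∃ (M : PartialModel (deleteVertex H v) G)
      (T : Sym2 ({v}ᶜ : Set W) → Set V), M.Avoids C ∧ Guards M T r (boundary G C) C) :
    ∃ f : V → ℕ, ∀ a ∈ D, (levelReach G D f r a).encard ≤
      ((numEdges (deleteVertex H v) * (2 * r + 1) + numIsolated (deleteVertex H v) : ℕ) : ℕ∞) := by
  classical
  induction hn : D.ncard using Nat.strong_induction_on generalizing D with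
  | _ n ih =>
    rcases D.eq_empty_or_nonempty with rfl | hne
    · exact ⟨0, fun a ha => ha.elim⟩
    obtain ⟨C, hC⟩ := exists_isComponent G hne
    obtain ⟨M₀, T₀, hA₀, h₀⟩ := hD C hC
    obtain ⟨X, hXC, hX, M, T, hA, hT⟩ := h₀.exists_step hG hA₀ hC.connected
    have hlt : (D \ X).ncard < n := by
      rw [← hn]
      refine Set.ncard_lt_ncard ⟨Set.sdiff_subset, fun hsub => ?_⟩
      obtain ⟨x, hx⟩ := hX
      exact (hsub (hC.subset (hXC hx))).2 hx
    obtain ⟨f, hf⟩ := ih _ hlt (D \ X) (fun C' hC' => by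
      by_cases hmeet : (C' ∩ C).Nonempty
      · have hsub : C' ⊆ C := hC.subset_of_connected (hC'.subset.trans Set.sdiff_subset)
          hC'.connected.preconnected hmeet
        refine ⟨M, T, hA.mono fun u hu => ⟨hsub hu, (hC'.subset hu).2⟩, hT.mono ?_ hsub⟩
        rintro u ⟨hu, a, ha, hau⟩
        by_cases huX : u ∈ X
        · exact .inr huX
        · refine .inl ⟨fun huC => hu ?_, a, hsub ha, hau⟩
          exact hC'.closed a ha u ⟨hC.subset huC, huX⟩ hau
      · refine hD C' ⟨hC'.subset.trans Set.sdiff_subset, hC'.connected, fun a ha b hb hab => ?_⟩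
        refine hC'.closed a ha b ⟨hb, fun hbX => hmeet ⟨a, ha, ?_⟩⟩ hab
        exact hC.closed b (hXC hbX) a (hC'.subset ha).1 hab.symm) rfl
    -- paths on levels not below a vertex outside `X` avoid `X`, because `X` is the bottom level
    let g : V → ℕ := fun u => if u ∈ X then 0 else f u + 1
    have hgX : ∀ u, u ∈ X → g u = 0 := fun u hu => if_pos hu
    have hgf : ∀ u, u ∉ X → g u = f u + 1 := fun u hu => if_neg hu
    refine ⟨g, fun a ha => ?_⟩
    by_cases haX : a ∈ X
    -- a path from `X` that stays in `D` stays in `C`, and ends in `X` or in the boundary of `C`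
    · refine (Set.encard_le_encard ?_).trans (hT.encard_reach_le (hXC haX))
      rintro u ⟨hu, p, hpath, hp, hw⟩
      obtain ⟨h1, h2⟩ := hC.path_mem p hpath (hXC haX) fun w h h' => (hw w h h').1
      refine ⟨?_, p, hp, h1⟩
      rcases h2 with huC | ⟨-, hub⟩
      · right
        by_contra huX
        have := hu (hC.subset huC)
        rw [hgX a haX, hgf u huX] at this
        omega
      · exact .inl hub
    · refine (Set.encard_le_encard ?_).trans (hf a ⟨ha, haX⟩)
      rintro u ⟨hu, p, hpath, hp, hw⟩
      refine ⟨fun huD => ?_, p, hpath, hp, fun w h h' => ?_⟩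
      · have := hu huD.1
        rw [hgf a haX, hgf u huD.2] at this
        omega
      · obtain ⟨hwD, hle⟩ := hw w h h'
        have hwX : w ∉ X := by
          intro hwX
          rw [hgf a haX, hgX w hwX] at hle
          omega
        rw [hgf a haX, hgf w hwX] at hle
        exact ⟨⟨hwD, hwX⟩, by omega⟩

/-- The partial model with nothing modelled. -/
def PartialModel.empty (H : SimpleGraph W) (G : SimpleGraph V) : PartialModel H G where
  core _ := ∅
  edges := ∅
  inner _ := ∅
  preconnected _ := fun a => a.2.elim
  disjoint_core _ _ _ := Set.disjoint_empty _
  disjoint_inner _ _ _ := Set.disjoint_empty _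
  disjoint_inner_core _ _ := Set.disjoint_empty _
  inner_eq_empty _ _ := rfl
  edges_subset := Set.empty_subset _
  linked _ _ h := h.elim

/-- Any function to `ℕ` on a finite type is monotone for some linear order on the type. -/
lemma exists_linearOrder_monotone [Finite V] (f : V → ℕ) :
    ∃ L : LinearOrder V, ∀ u v, L.le u v → f u ≤ f v := by
  obtain ⟨n, ⟨e⟩⟩ := Finite.exists_equiv_fin V
  let φ : V → ℕ ×ₗ Fin n := fun v => toLex (f v, e v)
  have hφ : Function.Injective φ := fun u v h => e.injective (congrArg (fun x => (ofLex x).2) h)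
  refine ⟨LinearOrder.lift' φ hφ, fun u v h => ?_⟩
  have h' : φ u ≤ φ v := h
  rw [Prod.Lex.le_iff] at h'
  rcases h' with h' | h'
  exacts [h'.le, h'.1.le]

end GenCol

theorem theorem1p2 {W V : Type*} [Finite W] [Finite V]
    (H : SimpleGraph W) (v : W) (G : SimpleGraph V) (hG : ¬ GenCol.IsMinor H G) (r : ℕ) :
    GenCol.col G r ≤
      ((GenCol.numEdges (GenCol.deleteVertex H v) * (2 * r + 1) +
        GenCol.numIsolated (GenCol.deleteVertex H v) : ℕ) : ℕ∞) := by
  obtain ⟨f, hf⟩ := GenCol.exists_level (v := v) hG r Set.univ fun C hC =>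
    ⟨GenCol.PartialModel.empty _ G, fun _ => ∅, ⟨fun _ => Set.empty_disjoint _,
      fun _ => Set.empty_disjoint _⟩, fun _ => by simp [GenCol.PartialModel.empty],
      fun u hu => by
        obtain ⟨huC, a, ha, hau⟩ := hu
        exact (huC (hC.closed a ha u (Set.mem_univ u) hau)).elim,
      fun _ _ => Set.empty_subset _, fun _ _ _ => by simp⟩
  obtain ⟨L, hL⟩ := GenCol.exists_linearOrder_monotone f
  refine (iInf_le _ L).trans (iSup_le fun a => ?_)
  -- vertices on the same level are ordered arbitrarily, which `levelReach` allows for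
  refine (Set.encard_le_encard ?_).trans (hf a (Set.mem_univ a))
  rintro u ⟨hu, p, hpath, hp, hw⟩
  refine ⟨fun _ => hL u a hu, p, hpath, hp, fun w hwp hwu => ⟨Set.mem_univ w, ?_⟩⟩
  by_cases hwa : w = a
  · rw [hwa]
  · exact hL a w ((L.lt_iff_le_not_ge a w).1 (hw w hwp hwa hwu)).1
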